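/- Let $n\ge 1$ and let $K\subset\mathbb R^n$ be a compact convex set with $0\in\operatorname{int}K$, whose boundary is of class $C^2$ with all principal curvatures strictly positive. Let $K^0=\{p:\langle p,x\rangle\le 1\ \forall x\in K\}$, and let $\rho,\rho^0$ be the gauge functions of $K$ and $K^0$, i.e. $\rho(\xi)=\inf\{t\ge 0:\xi\in tK\}$ and likewise $\rho^0$ with $K^0$. Let $\Omega\subset\mathbb R^n$ be a nonempty, bounded, open, connected set and put $$d(x)=\min_{y\in\partial\Omega}\rho^0(x-y),\qquad \Pi(x)=\{y\in\partial\Omega: d(x)=\rho^0(x-y)\}\qquad(x\in\overline\Omega).$$ Let $\Sigma$ be the set of points of $\Omega$ at which $d$ is not differentiable. Let $\mathrm{Lip}^1_0(\Omega,\rho)$ be the set of all $u\in C(\overline\Omega)$ with $u=0$ on $\partial\Omega$ and $u(x)-u(y)\le\rho^0(x-y)$ for all $x,y$ such that the segment $[x,y]$ is contained in $\overline\Omega$. Let $S\subseteq\overline\Omega$ be closed, write $]y,z[\,=[y,z]\setminus\{y,z\}$, and set $$u_S(x)=\max_{z\in S\cup\partial\Omega}\,[d(z)-\rho^0(z-x)]\quad(x\in\overline\Omega),\qquad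 T_S=\bigcup_{z\in S,\ y\in\Pi(z)}\,]y,z[\,.$$ Then the minimum and the maximum defining $d(x)$ and $u_S(x)$ are attained for every $x\in\overline\Omega$, and the following hold. (i) $u_S\in\mathrm{Lip}^1_0(\Omega,\rho)$. (ii) $u_S\le d$ in $\overline\Omega$, and $u_S=d$ in $\overline{T_S}\cup S$. Moreover, for every $z\in S\cap\Omega$, $y\in\Pi(z)$ and $x\in\,]y,z[$, both $d$ and $u_S$ are differentiable at $x$ and $Du_S(x)=Dd(x)$. (iii) If $u\in\mathrm{Lip}^1_0(\Omega,\rho)$ and $u=d$ in $S$, then $u\ge u_S$ in $\Omega$. (iv) $\rho(Du_S(x))=1$ at every $x\in\Omega\setminus S$ where $u_S$ is differentiable. (v) $u_S=d$ in $\Omega$ if and only if $\Sigma\subseteq S$. -/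

import Mathlib

open Set
open scoped Gradient

namespace MaxConv

noncomputable section

/-- `ℝⁿ` with its Euclidean structure. -/
abbrev E (n : ℕ) : Type := EuclideanSpace ℝ (Fin n)

variable {n : ℕ}

/-- On the open set `U` the function `φ` is a `C²` defining function of `K`: its gradient does not
vanish, it is negative exactly on the interior of `K` and zero exactly on the boundary of `K`. -/
structure IsDefiningFunction (K U : Set (E n)) (φ : E n → ℝ) : Prop where
  isOpen : IsOpen U
  contDiffOn : ContDiffOn ℝ 2 φ U
  gradient_ne_zero : ∀ x ∈ U, ∇ φ x ≠ 0
  neg_iff : ∀ x ∈ U, φ x < 0 ↔ x ∈ interior K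
  zero_iff : ∀ x ∈ U, φ x = 0 ↔ x ∈ frontier K

/-- The boundary of `K` is of class `C²`: near each of its points, `K` has a `C²` defining
function. -/
def HasC2Boundary (K : Set (E n)) : Prop :=
  ∀ x ∈ frontier K, ∃ (U : Set (E n)) (φ : E n → ℝ), x ∈ U ∧ IsDefiningFunction K U φ

/-- The unit normal field `∇φ / |∇φ|` of the level sets of `φ`. If `φ` is a defining function of
`K`, it is the outward unit normal of `K` along the boundary of `K`. -/
def unitNormal (φ : E n → ℝ) (x : E n) : E n := ‖∇ φ x‖⁻¹ • ∇ φ x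

/-- `κ` is a principal curvature of the boundary of `K` at `x`: an eigenvalue of the
Weingarten map, i.e. of the differential of the outward unit normal on the tangent space at `x`. -/
def IsPrincipalCurvature (K : Set (E n)) (x : E n) (κ : ℝ) : Prop :=
  x ∈ frontier K ∧ ∃ (U : Set (E n)) (φ : E n → ℝ), x ∈ U ∧ IsDefiningFunction K U φ ∧
    ∃ v : E n, v ≠ 0 ∧ inner ℝ (unitNormal φ x) v = 0 ∧
      fderiv ℝ (unitNormal φ) x v = κ • v

/-- Compact convex sets with the origin as an interior point, with boundary of class `C²` and
strictly positive principal curvatures (class `C²₊`). -/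
structure IsC2PlusBody (K : Set (E n)) : Prop where
  isCompact : IsCompact K
  convex : Convex ℝ K
  zero_mem_interior : (0 : E n) ∈ interior K
  hasC2Boundary : HasC2Boundary K
  curvature_pos : ∀ x κ, IsPrincipalCurvature K x κ → 0 < κ

/-- The polar set `K⁰ = {p | ⟨p, x⟩ ≤ 1 for all x ∈ K}`. -/
def polarSet (K : Set (E n)) : Set (E n) := {p | ∀ x ∈ K, inner ℝ p x ≤ 1}

/-- `ρ`, the gauge function of `K`. -/
abbrev rho (K : Set (E n)) (ξ : E n) : ℝ := gauge K ξ

/-- `ρ⁰`, the gauge function of the polar set of `K`. -/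
abbrev rho0 (K : Set (E n)) (ξ : E n) : ℝ := gauge (polarSet K) ξ

/-- The Minkowski distance from the boundary, `d(x) = min_{y ∈ ∂Ω} ρ⁰(x - y)`. -/
def dist0 (K Ω : Set (E n)) (x : E n) : ℝ :=
  sInf ((fun y => rho0 K (x - y)) '' frontier Ω)

/-- The set `Π(x)` of projections of `x` on `∂Ω`. -/
def proj (K Ω : Set (E n)) (x : E n) : Set (E n) :=
  {y | y ∈ frontier Ω ∧ dist0 K Ω x = rho0 K (x - y)}

/-- The singular set `Σ`: the points of `Ω` where `d` is not differentiable. -/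
def singularSet (K Ω : Set (E n)) : Set (E n) :=
  {x | x ∈ Ω ∧ ¬ DifferentiableAt ℝ (dist0 K Ω) x}

/-- `u ∈ Lip¹(Ω, ρ)`. Only the values of `u` on the closure of `Ω` matter. -/
def MemLip1 (K Ω : Set (E n)) (u : E n → ℝ) : Prop :=
  ContinuousOn u (closure Ω) ∧
    ∀ x y, segment ℝ x y ⊆ closure Ω → u x - u y ≤ rho0 K (x - y)

/-- `u ∈ Lip₀¹(Ω, ρ)`. -/
def MemLip10 (K Ω : Set (E n)) (u : E n → ℝ) : Prop :=
  MemLip1 K Ω u ∧ ∀ y ∈ frontier Ω, u y = 0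

/-- The segment `]x, y[ = [x, y] ∖ {x, y}` (empty if `x = y`). -/
def openSeg (x y : E n) : Set (E n) := segment ℝ x y \ {x, y}

/-- The transport set `T_S`, the union of the `]y, z[` with `z ∈ S` and `y ∈ Π(z)`. -/
def transportSet (K Ω S : Set (E n)) : Set (E n) :=
  ⋃ z ∈ S, ⋃ y ∈ proj K Ω z, openSeg y z

/-- `u_S(x) = max_{z ∈ S ∪ ∂Ω} [d(z) - ρ⁰(z - x)]`. -/
def maxConv (K Ω S : Set (E n)) (x : E n) : ℝ :=
  sSup ((fun z => dist0 K Ω z - rho0 K (z - x)) '' (S ∪ frontier Ω))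

end

end MaxConv

open MaxConv

/-! The gauge `ρ⁰` is the support function of `K`, hence an asymmetric norm. So `d` is 1-Lipschitz
for it, and `u_S` is the upper envelope of the cones `d(z) - ρ⁰(z - ·)`. Part (i), the bound `u_S ≤
d` and equality on `S` and on transport segments are then triangle inequalities. For (iii), if `[z,
x]` leaves the closure of `Ω`, the last exit point before `x` replaces `z`.

Curvature enters only through differentiability of `ρ⁰` off the origin
(`IsC2PlusBody.hasGradientAt_rho0`): along a segment in `∂K` the normal is constant, which gives a
zero principal curvature; so maximizers of linear functionals over `K` are unique. A function that
touches a lower cone `c - ρ⁰(z - ·)` and an upper cone `ρ⁰(· - y)` at `x` and lies between them is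
then differentiable at `x`. This gives the gradient claim in (ii) and one half of (v); (iv) reads
the gradient off the touching lower cone.

If `Σ ⊆ S`, climb from `x ∈ Ω`: among the points `w` with `d(w) = d(x) + ρ⁰(w - x)` take one of
maximal `d`. Were it outside `S`, `d` would be differentiable nearby and could grow further at unit
rate (`exists_dist0_eq_add`). So `w ∈ S`, and its cone gives `u_S(x) ≥ d(x)`. -/

namespace MaxConv

open Filter Topology

variable {n : ℕ} {K Ω S : Set (E n)}

/-! ### One-sided derivatives and touching functions. -/

/-- A one-sided first-order condition: a function that grows at least at rate `c` in the
direction `e` has a derivative of at least `c` in that direction. -/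
theorem le_fderiv_of_eventually_le {f : E n → ℝ} {L : E n →L[ℝ] ℝ} {x e : E n} {c : ℝ}
    (hf : HasFDerivAt f L x) (h : ∀ᶠ t : ℝ in 𝓝[>] 0, f x + t * c ≤ f (x + t • e)) : c ≤ L e := by
  have hline : HasDerivAt (fun t : ℝ => x + t • e) e 0 := by
    simpa using ((hasDerivAt_id (0 : ℝ)).smul_const e).const_add x
  have hf' : HasFDerivAt f L (x + (0 : ℝ) • e) := by simpa using hf
  have hd : HasDerivAt (fun t : ℝ => f (x + t • e)) (L e) 0 :=
    hf'.comp_hasDerivAt (0 : ℝ) hline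
  have ht := (hasDerivAt_iff_tendsto_slope.1 hd).mono_left
    (nhdsWithin_mono (0 : ℝ) (s := Ioi 0) fun t ht => ne_of_gt ht)
  refine ge_of_tendsto ht ?_
  filter_upwards [h, self_mem_nhdsWithin] with t ht ht0
  have ht0 : (0 : ℝ) < t := ht0
  simp only [slope_def_field, zero_smul, add_zero, sub_zero]
  rw [le_div_iff₀ ht0]
  linarith

/-- Two functions that enclose `g` and touch it at `x` force `g` to be differentiable there. -/
theorem hasFDerivAt_of_le_of_le {f g h : E n → ℝ} {L L' : E n →L[ℝ] ℝ} {x : E n}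
    (hf : HasFDerivAt f L x) (hh : HasFDerivAt h L' x)
    (hfg : ∀ w, f w ≤ g w) (hgh : ∀ w, g w ≤ h w) (hfx : f x = g x) (hhx : g x = h x) :
    HasFDerivAt g L x := by
  have hmin : IsLocalMin (fun w => h w - f w) x :=
    Eventually.of_forall fun w => by
      have := hfg w; have := hgh w
      simp only; linarith
  have hLL : L' = L := sub_eq_zero.1 (hmin.hasFDerivAt_eq_zero (hh.sub hf))
  subst hLL
  rw [hasFDerivAt_iff_isLittleO] at hf hh ⊢
  refine (Asymptotics.IsBigO.of_bound 1 (Eventually.of_forall fun w => ?_)).trans_isLittleO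
    (hf.norm_left.add hh.norm_left)
  simp only [Real.norm_eq_abs, one_mul]
  rw [abs_of_nonneg (a := _ + _) (by positivity), abs_le]
  have h1 := neg_abs_le (f w - f x - L' (w - x))
  have h2 := le_abs_self (h w - h x - L' (w - x))
  have h3 := abs_nonneg (f w - f x - L' (w - x))
  have h4 := abs_nonneg (h w - h x - L' (w - x))
  have := hfg w; have := hgh w
  constructor <;> linarith

/-! ### The polar gauge as the support function of `K`. -/

theorem convex_polarSet (K : Set (E n)) : Convex ℝ (polarSet K) := by
  intro p hp q hq a b ha hb hab x hx
  rw [inner_add_left, real_inner_smul_left, real_inner_smul_left]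
  nlinarith [mul_le_mul_of_nonneg_left (hp x hx) ha, mul_le_mul_of_nonneg_left (hq x hx) hb]

theorem polarSet_mem_nhds_zero (hK : Bornology.IsBounded K) : polarSet K ∈ 𝓝 (0 : E n) := by
  obtain ⟨R, hR, hKR⟩ := hK.exists_pos_norm_le
  refine Filter.mem_of_superset (Metric.ball_mem_nhds 0 (inv_pos.2 hR)) fun p hp x hx => ?_
  have hp : ‖p‖ < R⁻¹ := by simpa using hp
  calc inner ℝ p x ≤ ‖p‖ * ‖x‖ := real_inner_le_norm p x
    _ ≤ R⁻¹ * R := mul_le_mul hp.le (hKR x hx) (norm_nonneg _) (inv_pos.2 hR).le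
    _ = 1 := inv_mul_cancel₀ hR.ne'

theorem rho0_zero : rho0 K 0 = 0 := gauge_zero

theorem rho0_nonneg (x : E n) : 0 ≤ rho0 K x := gauge_nonneg x

theorem rho0_smul {t : ℝ} (ht : 0 ≤ t) (x : E n) : rho0 K (t • x) = t * rho0 K x :=
  gauge_smul_of_nonneg ht x

theorem rho0_add_le (hK : Bornology.IsBounded K) (x y : E n) :
    rho0 K (x + y) ≤ rho0 K x + rho0 K y :=
  gauge_add_le (convex_polarSet K) (absorbent_nhds_zero (polarSet_mem_nhds_zero hK)) x y

theorem rho0_sub_le (hK : Bornology.IsBounded K) (x y z : E n) :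
    rho0 K (x - z) ≤ rho0 K (x - y) + rho0 K (y - z) := by
  simpa using rho0_add_le hK (x - y) (y - z)

theorem continuous_rho0 (hK : Bornology.IsBounded K) : Continuous (rho0 K) :=
  continuous_gauge (convex_polarSet K) (polarSet_mem_nhds_zero hK)

theorem inner_le_rho0 (hK : Bornology.IsBounded K) {k : E n} (hk : k ∈ K) (x : E n) :
    inner ℝ k x ≤ rho0 K x := by
  refine le_of_forall_gt fun a ha => ?_
  obtain ⟨b, hb, hba, p, hp, rfl⟩ :=
    exists_lt_of_gauge_lt (absorbent_nhds_zero (polarSet_mem_nhds_zero hK)) ha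
  have := hp k hk
  simp only [real_inner_smul_right]
  rw [real_inner_comm]
  nlinarith

theorem rho0_le_of_forall_inner_le {x : E n} {a : ℝ} (ha : 0 < a)
    (h : ∀ k ∈ K, inner ℝ k x ≤ a) : rho0 K x ≤ a := by
  refine gauge_le_of_mem ha.le ((mem_smul_set_iff_inv_smul_mem₀ ha.ne' _ _).2 fun k hk => ?_)
  rw [real_inner_smul_left, real_inner_comm, inv_mul_le_iff₀ ha, mul_one]
  exact h k hk

theorem rho0_pos (hK : Bornology.IsBounded K) (h0 : (0 : E n) ∈ interior K) {x : E n}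
    (hx : x ≠ 0) : 0 < rho0 K x := by
  have hcont : Tendsto (fun t : ℝ => t • x) (𝓝[>] 0) (𝓝 0) := by
    have : Continuous fun t : ℝ => t • x := by fun_prop
    simpa using (this.tendsto 0).mono_left nhdsWithin_le_nhds
  obtain ⟨t, ht, ht0⟩ :=
    ((hcont.eventually (mem_interior_iff_mem_nhds.1 h0)).and self_mem_nhdsWithin).exists
  have ht0 : (0 : ℝ) < t := ht0
  refine lt_of_lt_of_le ?_ (inner_le_rho0 hK ht x)
  rw [real_inner_smul_left]
  exact mul_pos ht0 (real_inner_self_pos.2 hx)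

theorem exists_inner_eq_rho0 (hK : IsCompact K) (h0 : (0 : E n) ∈ interior K) (x : E n) :
    ∃ k ∈ K, inner ℝ k x = rho0 K x := by
  rcases eq_or_ne x 0 with rfl | hx
  · exact ⟨0, interior_subset h0, by simp⟩
  have hcont : ContinuousOn (fun k : E n => inner ℝ k x) K := by fun_prop
  obtain ⟨k, hk, hmax⟩ := hK.exists_isMaxOn ⟨0, interior_subset h0⟩ hcont
  refine ⟨k, hk, le_antisymm (inner_le_rho0 hK.isBounded hk x) ?_⟩
  by_contra! hlt
  have h0k : (0 : ℝ) ≤ inner ℝ k x := by simpa using hmax (interior_subset h0)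
  -- The maximum may a priori be `0`; a number strictly above it is positive, so the upper bound for
  -- `ρ⁰` applies.
  obtain ⟨a, ha, ha'⟩ := exists_between hlt
  exact absurd (rho0_le_of_forall_inner_le (h0k.trans_lt ha) fun w hw => (hmax hw).trans ha.le)
    (not_le.2 ha')

/-- If `ρ(k) < 1`, then `k = b w` with `b < 1` and `w ∈ K`, and `w` would beat the positive maximum
attained at `k`. -/
theorem rho_eq_one_of_inner_eq_rho0 (hK : IsCompact K) (h0 : (0 : E n) ∈ interior K) {k x : E n}
    (hx : x ≠ 0) (hk : k ∈ K) (hkx : inner ℝ k x = rho0 K x) : rho K k = 1 := by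
  refine le_antisymm (gauge_le_one_of_mem hk) ?_
  by_contra! hlt
  obtain ⟨b, hb, hb1, w, hw, rfl⟩ :=
    exists_lt_of_gauge_lt (absorbent_nhds_zero (mem_interior_iff_mem_nhds.1 h0)) hlt
  have h1 := inner_le_rho0 hK.isBounded hw x
  have h2 := rho0_pos hK.isBounded h0 hx
  simp only [real_inner_smul_left] at hkx
  nlinarith

/-! ### Strict convexity of `K` and differentiability of `ρ⁰`. -/

/-- A point of `K` that maximizes a nonzero linear functional is not in the interior of `K`. -/
theorem notMem_interior_of_inner_ge (hK : Bornology.IsBounded K) {p w : E n} (hp : p ≠ 0)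
    (hw : rho0 K p ≤ inner ℝ w p) : w ∉ interior K := by
  intro hwi
  have hcont : Tendsto (fun t : ℝ => w + t • p) (𝓝[>] 0) (𝓝 w) := by
    have : Continuous fun t : ℝ => w + t • p := by fun_prop
    simpa using (this.tendsto 0).mono_left nhdsWithin_le_nhds
  obtain ⟨t, ht, ht0⟩ :=
    ((hcont.eventually (mem_interior_iff_mem_nhds.1 hwi)).and self_mem_nhdsWithin).exists
  have ht0 : (0 : ℝ) < t := ht0
  have h := inner_le_rho0 hK ht p
  rw [inner_add_left, real_inner_smul_left] at h
  have := mul_pos ht0 (real_inner_self_pos.2 hp)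
  linarith

/-- At a point where the functional `p` attains its maximum over `K`, the unit normal of `K`
is the direction of `p`. -/
theorem unitNormal_eq_of_inner_eq_rho0 (hK : IsCompact K) {U : Set (E n)} {φ : E n → ℝ}
    (hφ : IsDefiningFunction K U φ) {p q : E n} (hp : p ≠ 0) (hqU : q ∈ U) (hqK : q ∈ K)
    (hqp : inner ℝ q p = rho0 K p) : unitNormal φ q = ‖p‖⁻¹ • p := by
  have hU : U ∈ 𝓝 q := hφ.isOpen.mem_nhds hqU
  have hdiff : DifferentiableAt ℝ φ q :=
    ((hφ.contDiffOn.contDiffAt hU).differentiableAt (by norm_num))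
  set g := ∇ φ q with hg
  have hq0 : φ q = 0 := (hφ.zero_iff q hqU).2
    ⟨subset_closure hqK, notMem_interior_of_inner_ge hK.isBounded hp hqp.ge⟩
  -- For such `e`, `q + t e` does not fall behind the supporting hyperplane, so it is not interior
  -- and `φ ≥ 0` there.
  have key : ∀ e : E n, 0 ≤ inner ℝ e p → 0 ≤ inner ℝ g e := by
    intro e he
    have hline : Tendsto (fun t : ℝ => q + t • e) (𝓝[>] 0) (𝓝 q) := by
      have : Continuous fun t : ℝ => q + t • e := by fun_prop
      simpa using (this.tendsto 0).mono_left nhdsWithin_le_nhds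
    rw [hg, inner_gradient_left]
    refine le_fderiv_of_eventually_le hdiff.hasFDerivAt ?_
    filter_upwards [hline.eventually hU, self_mem_nhdsWithin] with t htU ht
    have ht : (0 : ℝ) < t := ht
    rw [hq0, mul_zero, add_zero]
    by_contra! hneg
    refine notMem_interior_of_inner_ge hK.isBounded hp ?_ ((hφ.neg_iff _ htU).1 hneg)
    rw [inner_add_left, real_inner_smul_left, hqp]
    nlinarith
  have hgp : 0 ≤ inner ℝ g p := key p real_inner_self_nonneg
  have hpp : (0 : ℝ) < ‖p‖ ^ 2 := by positivity
  -- Up to the factor `‖p‖²`, this vector `e` is minus the component of `g` orthogonal to `p`; `key`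
  -- applied to it forces `⟨e, e⟩ ≤ 0`.
  have hgeq : inner ℝ g p • p - ‖p‖ ^ 2 • g = 0 := by
    set e := inner ℝ g p • p - ‖p‖ ^ 2 • g with he
    have hep : inner ℝ p e = (0 : ℝ) := by
      rw [he, inner_sub_right, real_inner_smul_right, real_inner_smul_right,
        real_inner_self_eq_norm_sq, real_inner_comm]
      ring
    have hge := key e (real_inner_comm e p ▸ hep.ge)
    have hee : inner ℝ e e = -(‖p‖ ^ 2 * inner ℝ g e) := by
      nth_rewrite 1 [he]
      rw [inner_sub_left, real_inner_smul_left, real_inner_smul_left, hep]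
      ring
    refine inner_self_eq_zero.1 (le_antisymm ?_ (real_inner_self_nonneg (x := e)))
    rw [hee]
    nlinarith
  have hgeq' : g = ((‖p‖ ^ 2)⁻¹ * inner ℝ g p) • p := by
    rw [mul_smul, sub_eq_zero.1 hgeq, smul_smul, inv_mul_cancel₀ hpp.ne', one_smul]
  have hg0 : g ≠ 0 := hφ.gradient_ne_zero q hqU
  have hc : 0 < (‖p‖ ^ 2)⁻¹ * inner ℝ g p := by
    refine lt_of_le_of_ne (by positivity) fun h => hg0 ?_
    rw [hgeq', ← h, zero_smul]
  rw [unitNormal, ← hg]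
  generalize (‖p‖ ^ 2)⁻¹ * inner ℝ g p = c at hc hgeq'
  rw [hgeq', norm_smul, Real.norm_of_nonneg hc.le, smul_smul]
  congr 1
  field_simp

theorem differentiableAt_unitNormal {U : Set (E n)} {φ : E n → ℝ}
    (hφ : IsDefiningFunction K U φ) {x : E n} (hx : x ∈ U) :
    DifferentiableAt ℝ (unitNormal φ) x := by
  have hfd : DifferentiableAt ℝ (fderiv ℝ φ) x :=
    ((hφ.contDiffOn.contDiffAt (hφ.isOpen.mem_nhds hx)).fderiv_right
      (m := 1) (by norm_num)).differentiableAt (by norm_num)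
  have hgrad : DifferentiableAt ℝ (∇ φ) x :=
    (InnerProductSpace.toDual ℝ (E n)).symm.differentiable.differentiableAt.comp x hfd
  have h0 := hφ.gradient_ne_zero x hx
  exact ((hgrad.norm ℝ h0).inv (norm_ne_zero_iff.2 h0)).smul hgrad

/-- A body of class `C²₊` is strictly convex: a nonzero functional attains its maximum over `K`
at one point only. -/
theorem IsC2PlusBody.eq_of_inner_eq_rho0 (hK : IsC2PlusBody K) {p a b : E n} (hp : p ≠ 0)
    (ha : a ∈ K) (hb : b ∈ K) (hap : inner ℝ a p = rho0 K p) (hbp : inner ℝ b p = rho0 K p) :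
    a = b := by
  by_contra hab
  set v := b - a with hv
  have hv0 : v ≠ 0 := sub_ne_zero.2 (Ne.symm hab)
  have hvp : inner ℝ v p = (0 : ℝ) := by rw [hv, inner_sub_left, hap, hbp, sub_self]
  -- At the midpoint, `x + t v` stays in `[a, b]` for small `t` of both signs, so a two-sided
  -- derivative is available.
  set x := a + (1 / 2 : ℝ) • v with hx
  have hline : ∀ t : ℝ, |t| ≤ 1 / 2 → x + t • v ∈ K := by
    intro t ht
    obtain ⟨h1, h2⟩ := abs_le.1 ht
    have := hK.convex ha hb (a := 1 / 2 - t) (b := 1 / 2 + t) (by linarith) (by linarith) (by ring)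
    convert this using 1
    rw [hx, hv]
    module
  have hlinep : ∀ t : ℝ, inner ℝ (x + t • v) p = rho0 K p := by
    intro t
    rw [hx, inner_add_left, inner_add_left, real_inner_smul_left, real_inner_smul_left, hvp, hap]
    ring
  have hxK : x ∈ K := by simpa using hline 0 (by norm_num)
  have hxp : inner ℝ x p = rho0 K p := by simpa using hlinep 0
  have hxf : x ∈ frontier K :=
    ⟨subset_closure hxK, notMem_interior_of_inner_ge hK.isCompact.isBounded hp hxp.ge⟩
  obtain ⟨U, φ, hxU, hφ⟩ := hK.hasC2Boundary x hxf
  have hN := unitNormal_eq_of_inner_eq_rho0 hK.isCompact hφ hp hxU hxK hxp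
  have hd : HasDerivAt (fun t : ℝ => unitNormal φ (x + t • v)) (fderiv ℝ (unitNormal φ) x v) 0 := by
    have h1 : HasDerivAt (fun t : ℝ => x + t • v) v 0 := by
      simpa using ((hasDerivAt_id (0 : ℝ)).smul_const v).const_add x
    have h2 : HasFDerivAt (unitNormal φ) (fderiv ℝ (unitNormal φ) x) (x + (0 : ℝ) • v) := by
      simpa using (differentiableAt_unitNormal hφ hxU).hasFDerivAt
    exact h2.comp_hasDerivAt (0 : ℝ) h1
  have hconst : (fun t : ℝ => unitNormal φ (x + t • v)) =ᶠ[𝓝 0] fun _ => ‖p‖⁻¹ • p := by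
    have hcont : Tendsto (fun t : ℝ => x + t • v) (𝓝 0) (𝓝 x) := by
      have : Continuous fun t : ℝ => x + t • v := by fun_prop
      simpa using this.tendsto 0
    filter_upwards [hcont.eventually (hφ.isOpen.mem_nhds hxU),
      Metric.closedBall_mem_nhds (0 : ℝ) (by norm_num : (0 : ℝ) < 1 / 2)] with t htU ht
    exact unitNormal_eq_of_inner_eq_rho0 hK.isCompact hφ hp htU (hline t (by simpa using ht))
      (hlinep t)
  have hzero : fderiv ℝ (unitNormal φ) x v = 0 :=
    hd.unique ((hasDerivAt_const (0 : ℝ) _).congr_of_eventuallyEq hconst)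
  refine lt_irrefl (0 : ℝ) (hK.curvature_pos x 0 ⟨hxf, U, φ, hxU, hφ, v, hv0, ?_, ?_⟩)
  · rw [hN, real_inner_smul_left, real_inner_comm, hvp, mul_zero]
  · rw [hzero, zero_smul]

/-- The gauge of the polar body is differentiable away from the origin, and its gradient is the
point of `K` that maximizes the corresponding functional. -/
theorem IsC2PlusBody.hasGradientAt_rho0 (hK : IsC2PlusBody K) {p k : E n} (hp : p ≠ 0)
    (hk : k ∈ K) (hkp : inner ℝ k p = rho0 K p) : HasGradientAt (rho0 K) k p := by
  have hb := hK.isCompact.isBounded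
  choose s hsK hs using exists_inner_eq_rho0 hK.isCompact hK.zero_mem_interior
  -- A maximizer `s w` for `w` near `p` almost maximizes `p`; its cluster points are therefore
  -- maximizers for `p`, of which `k` is the only one.
  have hval : Tendsto (fun w => inner ℝ (s w) p) (𝓝 p) (𝓝 (rho0 K p)) := by
    obtain ⟨R, hR, hKR⟩ := hb.exists_pos_norm_le
    have hsmall : Tendsto (fun w => inner ℝ (s w) (w - p)) (𝓝 p) (𝓝 0) := by
      refine squeeze_zero_norm (a := fun w => R * ‖w - p‖) (fun w => ?_) ?_
      · exact (norm_inner_le_norm _ _).trans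
          (mul_le_mul_of_nonneg_right (hKR _ (hsK w)) (norm_nonneg _))
      · have : Continuous fun w : E n => R * ‖w - p‖ := by fun_prop
        simpa using this.tendsto p
    have := ((continuous_rho0 hb).tendsto p).sub hsmall
    simp only [sub_zero] at this
    refine this.congr fun w => ?_
    rw [inner_sub_right, hs]
    ring
  have hlim : Tendsto s (𝓝 p) (𝓝 k) := by
    refine hK.isCompact.tendsto_nhds_of_unique_mapClusterPt (Eventually.of_forall hsK) ?_
    intro y hy hcl
    refine hK.eq_of_inner_eq_rho0 hp hy hk ?_ hkp
    have hcl' : MapClusterPt (inner ℝ y p) (𝓝 p) ((fun w => inner ℝ w p) ∘ s) :=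
      MapClusterPt.continuousAt_comp (f := fun w : E n => (inner ℝ w p : ℝ)) (by fun_prop) hcl
    exact eq_of_nhds_neBot (hcl'.neBot.mono (inf_le_inf_left _ hval))
  rw [hasGradientAt_iff_isLittleO, Asymptotics.isLittleO_iff]
  intro c hc
  filter_upwards [hlim.eventually (Metric.closedBall_mem_nhds k hc)] with w hw
  have hw : ‖s w - k‖ ≤ c := by simpa [dist_eq_norm] using hw
  -- The remainder `ρ⁰(w) - ρ⁰(p) - ⟨k, w - p⟩` lies between `0` and `⟨s w - k, w - p⟩`.
  have h1 : inner ℝ k w ≤ rho0 K w := inner_le_rho0 hb hk w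
  have h2 : inner ℝ (s w) p ≤ rho0 K p := inner_le_rho0 hb (hsK w) p
  have h3 : inner ℝ (s w - k) (w - p) ≤ c * ‖w - p‖ :=
    (real_inner_le_norm _ _).trans (mul_le_mul_of_nonneg_right hw (norm_nonneg _))
  rw [inner_sub_left, inner_sub_right, inner_sub_right, hs] at h3
  rw [Real.norm_eq_abs, inner_sub_right, abs_of_nonneg (by linarith)]
  linarith

/-! ### The distance `d`. -/

theorem continuous_of_sub_le_rho0 (hK : Bornology.IsBounded K) {u : E n → ℝ}
    (hu : ∀ x y, u x - u y ≤ rho0 K (x - y)) : Continuous u := by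
  refine continuous_iff_continuousAt.2 fun x => ?_
  have h1 : Tendsto (fun w => u x - rho0 K (x - w)) (𝓝 x) (𝓝 (u x)) := by
    have : Continuous fun w => u x - rho0 K (x - w) :=
      continuous_const.sub ((continuous_rho0 hK).comp (by fun_prop))
    simpa [rho0_zero] using this.tendsto x
  have h2 : Tendsto (fun w => u x + rho0 K (w - x)) (𝓝 x) (𝓝 (u x)) := by
    have : Continuous fun w => u x + rho0 K (w - x) :=
      continuous_const.add ((continuous_rho0 hK).comp (by fun_prop))
    simpa [rho0_zero] using this.tendsto x
  refine tendsto_of_tendsto_of_tendsto_of_le_of_le h1 h2 (fun w => ?_) fun w => ?_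
  · have := hu x w
    simp only; linarith
  · have := hu w x
    simp only; linarith

theorem isLeast_dist0 (hK : Bornology.IsBounded K) (hc : IsCompact (frontier Ω))
    (hne : (frontier Ω).Nonempty) (x : E n) :
    IsLeast ((fun y => rho0 K (x - y)) '' frontier Ω) (dist0 K Ω x) := by
  have hcont : Continuous fun y => rho0 K (x - y) := (continuous_rho0 hK).comp (by fun_prop)
  exact (hc.image hcont).isLeast_sInf (hne.image _)

theorem dist0_le_rho0 (hK : Bornology.IsBounded K) (hc : IsCompact (frontier Ω)) {y : E n}
    (hy : y ∈ frontier Ω) (x : E n) : dist0 K Ω x ≤ rho0 K (x - y) :=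
  (isLeast_dist0 hK hc ⟨y, hy⟩ x).2 (mem_image_of_mem _ hy)

theorem exists_mem_proj (hK : Bornology.IsBounded K) (hc : IsCompact (frontier Ω))
    (hne : (frontier Ω).Nonempty) (x : E n) : ∃ y, y ∈ proj K Ω x := by
  obtain ⟨y, hy, hxy⟩ := (isLeast_dist0 hK hc hne x).1
  exact ⟨y, hy, hxy.symm⟩

theorem dist0_sub_le (hK : Bornology.IsBounded K) (hc : IsCompact (frontier Ω))
    (hne : (frontier Ω).Nonempty) (x y : E n) :
    dist0 K Ω x - dist0 K Ω y ≤ rho0 K (x - y) := by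
  obtain ⟨w, hw, hyw⟩ := exists_mem_proj hK hc hne y
  have h1 := dist0_le_rho0 hK hc hw x
  have h2 := rho0_sub_le hK x y w
  linarith

theorem continuous_dist0 (hK : Bornology.IsBounded K) (hc : IsCompact (frontier Ω))
    (hne : (frontier Ω).Nonempty) : Continuous (dist0 K Ω) :=
  continuous_of_sub_le_rho0 hK (dist0_sub_le hK hc hne)

theorem dist0_nonneg (x : E n) : 0 ≤ dist0 K Ω x :=
  Real.sInf_nonneg (by rintro _ ⟨y, -, rfl⟩; exact rho0_nonneg _)

theorem dist0_eq_zero (hK : Bornology.IsBounded K) (hc : IsCompact (frontier Ω)) {y : E n}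
    (hy : y ∈ frontier Ω) : dist0 K Ω y = 0 := by
  refine le_antisymm ?_ (dist0_nonneg y)
  simpa [rho0_zero] using dist0_le_rho0 hK hc hy y

theorem dist0_pos (hK : Bornology.IsBounded K) (h0 : (0 : E n) ∈ interior K)
    (hc : IsCompact (frontier Ω)) (hne : (frontier Ω).Nonempty) {x : E n}
    (hx : x ∉ frontier Ω) : 0 < dist0 K Ω x := by
  obtain ⟨y, hy, hxy⟩ := exists_mem_proj hK hc hne x
  rw [hxy]
  exact rho0_pos hK h0 (sub_ne_zero.2 fun h => hx (h ▸ hy))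

/-! ### The envelope `u_S` and its Lipschitz bound. -/

theorem isGreatest_maxConv (hK : Bornology.IsBounded K) (hc : IsCompact (frontier Ω))
    (hne : (frontier Ω).Nonempty) (hS : IsCompact S) (x : E n) :
    IsGreatest ((fun z => dist0 K Ω z - rho0 K (z - x)) '' (S ∪ frontier Ω))
      (maxConv K Ω S x) := by
  have hcont : Continuous fun z => dist0 K Ω z - rho0 K (z - x) :=
    (continuous_dist0 hK hc hne).sub ((continuous_rho0 hK).comp (by fun_prop))
  exact ((hS.union hc).image hcont).isGreatest_sSup ((hne.mono subset_union_right).image _)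

theorem le_maxConv (hK : Bornology.IsBounded K) (hc : IsCompact (frontier Ω))
    (hne : (frontier Ω).Nonempty) (hS : IsCompact S) {z : E n} (hz : z ∈ S ∪ frontier Ω)
    (x : E n) : dist0 K Ω z - rho0 K (z - x) ≤ maxConv K Ω S x :=
  (isGreatest_maxConv hK hc hne hS x).2 (mem_image_of_mem _ hz)

theorem exists_maxConv_eq (hK : Bornology.IsBounded K) (hc : IsCompact (frontier Ω))
    (hne : (frontier Ω).Nonempty) (hS : IsCompact S) (x : E n) :
    ∃ z ∈ S ∪ frontier Ω, maxConv K Ω S x = dist0 K Ω z - rho0 K (z - x) := by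
  obtain ⟨z, hz, hzx⟩ := (isGreatest_maxConv hK hc hne hS x).1
  exact ⟨z, hz, hzx.symm⟩

theorem maxConv_le_dist0 (hK : Bornology.IsBounded K) (hc : IsCompact (frontier Ω))
    (hne : (frontier Ω).Nonempty) (hS : IsCompact S) (x : E n) :
    maxConv K Ω S x ≤ dist0 K Ω x := by
  obtain ⟨z, -, hz⟩ := exists_maxConv_eq hK hc hne hS x
  have := dist0_sub_le hK hc hne z x
  linarith

theorem maxConv_sub_le (hK : Bornology.IsBounded K) (hc : IsCompact (frontier Ω))
    (hne : (frontier Ω).Nonempty) (hS : IsCompact S) (x y : E n) :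
    maxConv K Ω S x - maxConv K Ω S y ≤ rho0 K (x - y) := by
  obtain ⟨z, hz, hzx⟩ := exists_maxConv_eq hK hc hne hS x
  have h1 := le_maxConv hK hc hne hS hz y
  have h2 := rho0_sub_le hK z x y
  linarith

theorem continuous_maxConv (hK : Bornology.IsBounded K) (hc : IsCompact (frontier Ω))
    (hne : (frontier Ω).Nonempty) (hS : IsCompact S) : Continuous (maxConv K Ω S) :=
  continuous_of_sub_le_rho0 hK (maxConv_sub_le hK hc hne hS)

theorem maxConv_eq_dist0_of_mem (hK : Bornology.IsBounded K) (hc : IsCompact (frontier Ω))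
    (hne : (frontier Ω).Nonempty) (hS : IsCompact S) {x : E n} (hx : x ∈ S ∪ frontier Ω) :
    maxConv K Ω S x = dist0 K Ω x := by
  refine le_antisymm (maxConv_le_dist0 hK hc hne hS x) ?_
  simpa [rho0_zero] using le_maxConv hK hc hne hS hx x

theorem memLip10_maxConv (hK : Bornology.IsBounded K) (hc : IsCompact (frontier Ω))
    (hne : (frontier Ω).Nonempty) (hS : IsCompact S) : MemLip10 K Ω (maxConv K Ω S) :=
  ⟨⟨(continuous_maxConv hK hc hne hS).continuousOn,
    fun x y _ => maxConv_sub_le hK hc hne hS x y⟩, fun y hy => by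
      rw [maxConv_eq_dist0_of_mem hK hc hne hS (Or.inr hy), dist0_eq_zero hK hc hy]⟩

/-! ### Transport segments. -/

/-- On a segment, the triangle inequality for `ρ⁰`
is an equality. -/
theorem rho0_add_eq_of_mem_segment {x y z : E n} (hx : x ∈ segment ℝ y z) :
    rho0 K (z - x) + rho0 K (x - y) = rho0 K (z - y) := by
  obtain ⟨a, b, ha, hb, hab, rfl⟩ := hx
  have h1 : z - (a • y + b • z) = a • (z - y) := by
    obtain rfl : b = 1 - a := by linarith
    module
  have h2 : a • y + b • z - y = b • (z - y) := by
    obtain rfl : b = 1 - a := by linarith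
    module
  rw [h1, h2, rho0_smul ha, rho0_smul hb, ← add_mul, hab, one_mul]

/-- The inequalities `d(x) ≤ ρ⁰(x - y)` and `d(z) ≤ ρ⁰(z - x) + d(x)` must both be sharp, since
`d(z) = ρ⁰(z - y)` splits additively at `x`. -/
theorem dist0_sub_eq_of_mem_segment (hK : Bornology.IsBounded K) (hc : IsCompact (frontier Ω))
    (hne : (frontier Ω).Nonempty) {x y z : E n} (hy : y ∈ proj K Ω z) (hx : x ∈ segment ℝ y z) :
    dist0 K Ω z - rho0 K (z - x) = rho0 K (x - y) ∧ dist0 K Ω x = rho0 K (x - y) := by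
  have h1 := rho0_add_eq_of_mem_segment (K := K) hx
  have h2 := dist0_le_rho0 hK hc hy.1 x
  have h3 := dist0_sub_le hK hc hne z x
  have h4 := hy.2
  constructor <;> linarith

theorem maxConv_eq_dist0_of_mem_segment (hK : Bornology.IsBounded K)
    (hc : IsCompact (frontier Ω)) (hne : (frontier Ω).Nonempty) (hS : IsCompact S) {x y z : E n}
    (hz : z ∈ S) (hy : y ∈ proj K Ω z) (hx : x ∈ segment ℝ y z) :
    maxConv K Ω S x = dist0 K Ω x := by
  obtain ⟨h1, h2⟩ := dist0_sub_eq_of_mem_segment hK hc hne hy hx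
  refine le_antisymm (maxConv_le_dist0 hK hc hne hS x) ?_
  rw [h2, ← h1]
  exact le_maxConv hK hc hne hS (Or.inl hz) x

theorem maxConv_eq_dist0_of_mem_closure (hK : Bornology.IsBounded K)
    (hc : IsCompact (frontier Ω)) (hne : (frontier Ω).Nonempty) (hS : IsCompact S) {x : E n}
    (hx : x ∈ closure (transportSet K Ω S)) : maxConv K Ω S x = dist0 K Ω x := by
  refine closure_minimal ?_ (isClosed_eq (continuous_maxConv hK hc hne hS)
    (continuous_dist0 hK hc hne)) hx
  intro w hw
  simp only [transportSet, mem_iUnion] at hw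
  obtain ⟨z, hz, y, hy, hw⟩ := hw
  exact maxConv_eq_dist0_of_mem_segment hK hc hne hS hz hy hw.1

theorem IsC2PlusBody.differentiableAt_rho0 (hK : IsC2PlusBody K) {p : E n} (hp : p ≠ 0) :
    DifferentiableAt ℝ (rho0 K) p := by
  obtain ⟨k, hk, hkp⟩ := exists_inner_eq_rho0 hK.isCompact hK.zero_mem_interior p
  exact (hK.hasGradientAt_rho0 hp hk hkp).differentiableAt

theorem IsC2PlusBody.hasFDerivAt_rho0_sub_left (hK : IsC2PlusBody K) {z x : E n} (hzx : z ≠ x)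
    (c : ℝ) : HasFDerivAt (fun w => c - rho0 K (z - w)) (fderiv ℝ (rho0 K) (z - x)) x := by
  have h1 := (hK.differentiableAt_rho0 (sub_ne_zero.2 hzx)).hasFDerivAt
  simpa using (h1.comp x ((hasFDerivAt_id x).const_sub z)).const_sub c

theorem IsC2PlusBody.hasFDerivAt_rho0_sub_right (hK : IsC2PlusBody K) {x y : E n} (hxy : x ≠ y) :
    HasFDerivAt (fun w => rho0 K (w - y)) (fderiv ℝ (rho0 K) (x - y)) x := by
  have h1 := (hK.differentiableAt_rho0 (sub_ne_zero.2 hxy)).hasFDerivAt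
  simpa [Function.comp_def] using h1.comp x ((hasFDerivAt_id x).sub_const y)

/-- A function enclosed between `c - ρ⁰(z - ·)` and `ρ⁰(· - y)` and touching both at `x` is
differentiable at `x`. -/
theorem IsC2PlusBody.hasFDerivAt_of_le_of_le (hK : IsC2PlusBody K) {u : E n → ℝ} {x y z : E n}
    {c : ℝ} (hzx : z ≠ x) (hxy : x ≠ y) (h1 : ∀ w, c - rho0 K (z - w) ≤ u w)
    (h2 : ∀ w, u w ≤ rho0 K (w - y)) (h1x : c - rho0 K (z - x) = u x)
    (h2x : u x = rho0 K (x - y)) : HasFDerivAt u (fderiv ℝ (rho0 K) (z - x)) x :=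
  MaxConv.hasFDerivAt_of_le_of_le (hK.hasFDerivAt_rho0_sub_left hzx c)
    (hK.hasFDerivAt_rho0_sub_right hxy) h1 h2 h1x h2x

/-- Both functions are squeezed at `x` by the same two cones, so their derivatives agree. Excluding
the endpoints keeps `x` off the cone vertices. -/
theorem IsC2PlusBody.differentiableAt_of_mem_openSeg (hK : IsC2PlusBody K)
    (hc : IsCompact (frontier Ω)) (hne : (frontier Ω).Nonempty) (hS : IsCompact S) {x y z : E n}
    (hz : z ∈ S) (hy : y ∈ proj K Ω z) (hx : x ∈ openSeg y z) :
    DifferentiableAt ℝ (dist0 K Ω) x ∧ DifferentiableAt ℝ (maxConv K Ω S) x ∧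
      ∇ (maxConv K Ω S) x = ∇ (dist0 K Ω) x := by
  have hb := hK.isCompact.isBounded
  have hxy : x ≠ y := fun h => hx.2 (Or.inl h)
  have hzx : z ≠ x := fun h => hx.2 (Or.inr h.symm)
  obtain ⟨h1, h2⟩ := dist0_sub_eq_of_mem_segment hb hc hne hy hx.1
  have h3 := maxConv_eq_dist0_of_mem_segment hb hc hne hS hz hy hx.1
  have hd : HasFDerivAt (dist0 K Ω) (fderiv ℝ (rho0 K) (z - x)) x := by
    refine hK.hasFDerivAt_of_le_of_le hzx hxy (c := dist0 K Ω z) (fun w => ?_)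
      (dist0_le_rho0 hb hc hy.1) (h1.trans h2.symm) h2
    have := dist0_sub_le hb hc hne z w
    linarith
  have hu : HasFDerivAt (maxConv K Ω S) (fderiv ℝ (rho0 K) (z - x)) x :=
    hK.hasFDerivAt_of_le_of_le hzx hxy (c := dist0 K Ω z) (le_maxConv hb hc hne hS (Or.inl hz))
      (fun w => (maxConv_le_dist0 hb hc hne hS w).trans (dist0_le_rho0 hb hc hy.1 w))
      (h1.trans (h2.symm.trans h3.symm)) (h3.trans h2)
  refine ⟨hd.differentiableAt, hu.differentiableAt, ?_⟩
  rw [gradient, gradient, hd.fderiv, hu.fderiv]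

/-! ### Minimality of `u_S`. -/

/-- A segment that starts in `Ω` and leaves the closure of `Ω` meets the boundary at a point
before which it stays in the closure. -/
theorem exists_mem_frontier_segment (hΩ : IsOpen Ω) {x z : E n} (hx : x ∈ Ω)
    (hz : ¬ segment ℝ z x ⊆ closure Ω) :
    ∃ w ∈ frontier Ω, w ∈ segment ℝ x z ∧ segment ℝ w x ⊆ closure Ω := by
  let γ : ℝ → E n := fun t => x + t • (z - x)
  have hγ : Continuous γ := by fun_prop
  have hseg : segment ℝ x z = γ '' Icc 0 1 := segment_eq_image' ℝ x z
  rw [segment_symm, hseg] at hz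
  obtain ⟨_, ⟨t₁, ht₁, rfl⟩, hout⟩ := not_subset.1 hz
  let A : Set ℝ := {t ∈ Icc (0 : ℝ) 1 | γ t ∉ Ω}
  have hA : IsCompact A :=
    isCompact_Icc.inter_right (hΩ.isClosed_compl.preimage hγ)
  obtain ⟨t₀, ht₀, hmin⟩ := hA.exists_isLeast ⟨t₁, ht₁, fun h => hout (subset_closure h)⟩
  have hin : ∀ t ∈ Ico 0 t₀, γ t ∈ Ω := fun t ht => by
    by_contra hcon
    exact not_le.2 ht.2 (hmin ⟨⟨ht.1, ht.2.le.trans ht₀.1.2⟩, hcon⟩)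
  have hpos : 0 < t₀ := by
    refine lt_of_le_of_ne ht₀.1.1 fun h => ht₀.2 ?_
    rw [← h]
    simpa [γ] using hx
  have hclos : ∀ t ∈ Icc 0 t₀, γ t ∈ closure Ω := by
    have hsub : Icc 0 t₀ ⊆ closure (γ ⁻¹' Ω) := by
      rw [← closure_Ico hpos.ne]
      exact closure_mono hin
    exact fun t ht => hγ.closure_preimage_subset Ω (hsub ht)
  refine ⟨γ t₀, ⟨hclos t₀ (right_mem_Icc.2 hpos.le), ?_⟩, hseg ▸ mem_image_of_mem γ ht₀.1, ?_⟩
  · rw [hΩ.interior_eq]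
    exact ht₀.2
  · rw [segment_symm, segment_eq_image']
    rintro _ ⟨s, hs, rfl⟩
    have : x + s • (γ t₀ - x) = γ (s * t₀) := by
      simp only [γ]
      module
    simp only [this]
    exact hclos _ ⟨mul_nonneg hs.1 hpos.le, mul_le_of_le_one_left hpos.le hs.2⟩

theorem maxConv_le_of_memLip10 (hK : Bornology.IsBounded K) (hΩ : IsOpen Ω)
    (hc : IsCompact (frontier Ω)) (hne : (frontier Ω).Nonempty) (hS : IsCompact S)
    {u : E n → ℝ} (hu : MemLip10 K Ω u) (huS : ∀ x ∈ S, u x = dist0 K Ω x) {x : E n}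
    (hx : x ∈ Ω) : maxConv K Ω S x ≤ u x := by
  obtain ⟨z, hz, hzx⟩ := exists_maxConv_eq hK hc hne hS x
  rw [hzx]
  by_cases hseg : segment ℝ z x ⊆ closure Ω
  · have huz : u z = dist0 K Ω z := by
      rcases hz with hz | hz
      · exact huS z hz
      · rw [hu.2 z hz, dist0_eq_zero hK hc hz]
    have := hu.1.2 z x hseg
    linarith
  -- Here `d(z) - ρ⁰(z - x) ≤ ρ⁰(z - w) - ρ⁰(z - x) = -ρ⁰(w - x) ≤ u(x)`, as `u(w) = 0`.
  · obtain ⟨w, hw, hwseg, hwx⟩ := exists_mem_frontier_segment hΩ hx hseg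
    have h1 := hu.1.2 w x hwx
    have h2 := rho0_add_eq_of_mem_segment (K := K) hwseg
    have h3 := dist0_le_rho0 hK hc hw z
    have h4 := hu.2 w hw
    linarith

/-! ### The eikonal equation off `S`. -/

/-- The cone of a maximizing `z ≠ x` touches `u_S` from below at `x`, so the gradients agree; that
of the cone maximizes `⟨·, z - x⟩` over `K`. -/
theorem IsC2PlusBody.rho_gradient_maxConv (hK : IsC2PlusBody K) (hc : IsCompact (frontier Ω))
    (hne : (frontier Ω).Nonempty) (hS : IsCompact S) {x : E n} (hx : x ∉ S ∪ frontier Ω)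
    (hd : DifferentiableAt ℝ (maxConv K Ω S) x) : rho K (∇ (maxConv K Ω S) x) = 1 := by
  have hb := hK.isCompact.isBounded
  obtain ⟨z, hz, hzx⟩ := exists_maxConv_eq hb hc hne hS x
  have hne' : z ≠ x := fun h => hx (h ▸ hz)
  have hp := sub_ne_zero.2 hne'
  have hmin : IsLocalMin (fun w => maxConv K Ω S w - (dist0 K Ω z - rho0 K (z - w))) x :=
    Eventually.of_forall fun w => by
      have := le_maxConv hb hc hne hS hz w
      simp only; linarith
  have heq := sub_eq_zero.1 (hmin.hasFDerivAt_eq_zero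
    (hd.hasFDerivAt.sub (hK.hasFDerivAt_rho0_sub_left hne' _)))
  obtain ⟨k, hk, hkp⟩ := exists_inner_eq_rho0 hK.isCompact hK.zero_mem_interior (z - x)
  have hgrad : ∇ (maxConv K Ω S) x = k := by
    rw [gradient, heq]
    exact (hK.hasGradientAt_rho0 hp hk hkp).gradient
  rw [hgrad]
  exact rho_eq_one_of_inner_eq_rho0 hK.isCompact hK.zero_mem_interior hp hk hkp

/-! ### Equality `u_S = d` and the singular set. -/

/-- Off `S`, a maximizing `z` differs from `x`, so `u_S(x) = d(x)` supplies a lower cone touching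
`d`; a projection of `x` supplies the upper one. -/
theorem IsC2PlusBody.singularSet_subset (hK : IsC2PlusBody K) (hΩ : IsOpen Ω)
    (hc : IsCompact (frontier Ω)) (hne : (frontier Ω).Nonempty) (hS : IsCompact S)
    (h : ∀ x ∈ Ω, maxConv K Ω S x = dist0 K Ω x) : singularSet K Ω ⊆ S := by
  rintro x ⟨hxΩ, hnd⟩
  by_contra hxS
  have hb := hK.isCompact.isBounded
  have hxf : x ∉ frontier Ω := fun hf => by
    have := hΩ.inter_frontier_eq.subset ⟨hxΩ, hf⟩
    exact this
  obtain ⟨z, hz, hzx⟩ := exists_maxConv_eq hb hc hne hS x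
  obtain ⟨y, hy, hxy⟩ := exists_mem_proj hb hc hne x
  have hzx' : z ≠ x := fun h => (h ▸ hz).elim hxS hxf
  have hxy' : x ≠ y := fun h => hxf (h ▸ hy)
  refine hnd (hK.hasFDerivAt_of_le_of_le hzx' hxy' (c := dist0 K Ω z) (fun w => ?_)
    (dist0_le_rho0 hb hc hy) (hzx.symm.trans (h x hxΩ)) hxy).differentiableAt
  have := dist0_sub_le hb hc hne z w
  linarith

/-- If `d` is differentiable at a point off the boundary, then its slope there is at least `1`:
`d - θ ρ⁰(· - z)` has no local maximum for `θ < 1`. -/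
theorem not_isLocalMax_dist0_sub (hK : Bornology.IsBounded K) (h0 : (0 : E n) ∈ interior K)
    (hc : IsCompact (frontier Ω)) (hne : (frontier Ω).Nonempty) {w : E n} (hw : w ∉ frontier Ω)
    (hd : DifferentiableAt ℝ (dist0 K Ω) w) {θ : ℝ} (hθ0 : 0 ≤ θ) (hθ1 : θ < 1) (z : E n) :
    ¬ IsLocalMax (fun w => dist0 K Ω w - θ * rho0 K (w - z)) w := by
  intro hmax
  obtain ⟨y, hy, hwy⟩ := exists_mem_proj hK hc hne w
  have hpos : 0 < rho0 K (w - y) := rho0_pos hK h0 (sub_ne_zero.2 fun h => hw (h ▸ hy))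
  have hneg := hd.hasFDerivAt.neg
  -- Towards its projection `y`, `d` falls at rate at least `ρ⁰(w - y)`; a local maximum would allow
  -- growth of at most `θ ρ⁰(w - y)` in the opposite direction, against linearity of the derivative.
  have hup : rho0 K (w - y) ≤ (-fderiv ℝ (dist0 K Ω) w) (y - w) := by
    refine le_fderiv_of_eventually_le hneg ?_
    filter_upwards [Ioo_mem_nhdsGT (zero_lt_one (α := ℝ))] with t ht
    have h1 := dist0_le_rho0 hK hc hy (w + t • (y - w))
    have h2 : w + t • (y - w) - y = (1 - t) • (w - y) := by module
    rw [h2, rho0_smul (by linarith [ht.2])] at h1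
    simp only [Pi.neg_apply]
    linarith
  have hdown : -(θ * rho0 K (w - y)) ≤ (-fderiv ℝ (dist0 K Ω) w) (w - y) := by
    refine le_fderiv_of_eventually_le hneg ?_
    have hline : Tendsto (fun t : ℝ => w + t • (w - y)) (𝓝[>] 0) (𝓝 w) := by
      have : Continuous fun t : ℝ => w + t • (w - y) := by fun_prop
      simpa using (this.tendsto 0).mono_left nhdsWithin_le_nhds
    filter_upwards [hline.eventually hmax, self_mem_nhdsWithin] with t h1 ht
    have h2 := rho0_sub_le hK (w + t • (w - y)) w z
    rw [add_sub_cancel_left, rho0_smul (le_of_lt ht)] at h2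
    have h3 := mul_le_mul_of_nonneg_left h2 hθ0
    simp only [Pi.neg_apply]
    linarith
  rw [← neg_sub w y, map_neg] at hup
  nlinarith

/-- If `d` is differentiable near `z`, then `d` grows at unit rate from `z` to some point of each
small sphere around `z`. -/
theorem exists_dist0_eq_add (hn : 1 ≤ n) (hK : Bornology.IsBounded K)
    (h0 : (0 : E n) ∈ interior K) (hc : IsCompact (frontier Ω)) (hne : (frontier Ω).Nonempty)
    {z : E n} {r : ℝ} (hr : 0 < r)
    (hd : ∀ w ∈ Metric.ball z r, w ∉ frontier Ω ∧ DifferentiableAt ℝ (dist0 K Ω) w) :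
    ∃ w ∈ Metric.sphere z r, dist0 K Ω w = dist0 K Ω z + rho0 K (w - z) := by
  have : Nonempty (Fin n) := ⟨⟨0, hn⟩⟩
  have hρ : Continuous fun w => rho0 K (w - z) := (continuous_rho0 hK).comp (by fun_prop)
  have hdc := continuous_dist0 hK hc hne
  have hρpos : ∀ w ∈ Metric.sphere z r, 0 < rho0 K (w - z) := fun w hw =>
    rho0_pos hK h0 (sub_ne_zero.2 fun h => by
      rw [h, Metric.mem_sphere, dist_self] at hw
      exact hr.ne hw)
  have hquot : ContinuousOn (fun w => (dist0 K Ω w - dist0 K Ω z) / rho0 K (w - z))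
      (Metric.sphere z r) :=
    (hdc.sub continuous_const).continuousOn.div hρ.continuousOn fun w hw => (hρpos w hw).ne'
  obtain ⟨w, hw, hmax⟩ :=
    (isCompact_sphere z r).exists_isMaxOn (NormedSpace.sphere_nonempty.2 hr.le) hquot
  refine ⟨w, hw, ?_⟩
  by_contra hneq
  have hlt : (dist0 K Ω w - dist0 K Ω z) / rho0 K (w - z) < 1 := by
    rw [div_lt_one (hρpos w hw)]
    refine lt_of_le_of_ne (dist0_sub_le hK hc hne w z) fun h => hneq ?_
    linarith
  -- With this `θ`, `d - θ ρ⁰(· - z)` is smaller on the sphere than at the center, so it has a local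
  -- maximum inside the ball.
  obtain ⟨θ, hθ, hθ1⟩ := exists_between (max_lt hlt one_pos)
  obtain ⟨hθw, hθ0⟩ := max_lt_iff.1 hθ
  obtain ⟨v, hv, hmin⟩ := Metric.exists_isLocalMin_mem_ball
    (f := fun w => -(dist0 K Ω w - θ * rho0 K (w - z))) (a := z) (z := z) (r := r)
    (hdc.sub (continuous_const.mul hρ)).neg.continuousOn (Metric.mem_closedBall_self hr.le)
    (fun w' hw' => by
      have h1 : (dist0 K Ω w' - dist0 K Ω z) / rho0 K (w' - z) < θ :=
        lt_of_le_of_lt (hmax hw') hθw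
      rw [div_lt_iff₀ (hρpos w' hw')] at h1
      simp only [sub_self, rho0_zero]
      linarith)
  refine not_isLocalMax_dist0_sub hK h0 hc hne (hd v hv).1 (hd v hv).2 hθ0.le hθ1 z ?_
  simpa using hmin.neg

theorem maxConv_eq_dist0_of_singularSet_subset (hn : 1 ≤ n) (hK : Bornology.IsBounded K)
    (h0 : (0 : E n) ∈ interior K) (hΩ : IsOpen Ω) (hΩb : Bornology.IsBounded Ω)
    (hne : (frontier Ω).Nonempty) (hS : IsCompact S) (hsing : singularSet K Ω ⊆ S) {x : E n}
    (hx : x ∈ Ω) : maxConv K Ω S x = dist0 K Ω x := by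
  have hc : IsCompact (frontier Ω) := hΩb.isCompact_closure.of_isClosed_subset isClosed_frontier
    frontier_subset_closure
  have hnf : ∀ w ∈ Ω, w ∉ frontier Ω := fun w hw hf => by
    rw [frontier, hΩ.interior_eq] at hf
    exact hf.2 hw
  have hρ : Continuous fun w => rho0 K (w - x) := (continuous_rho0 hK).comp (by fun_prop)
  have hdc := continuous_dist0 hK hc hne
  let M : Set (E n) := {w | w ∈ closure Ω ∧ dist0 K Ω w = dist0 K Ω x + rho0 K (w - x)}
  have hM : IsCompact M :=
    hΩb.isCompact_closure.inter_right (isClosed_eq hdc (continuous_const.add hρ))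
  obtain ⟨w, ⟨hwΩ, hwx⟩, hmax⟩ :=
    hM.exists_isMaxOn ⟨x, subset_closure hx, by simp⟩ hdc.continuousOn
  have hwf : w ∉ frontier Ω := fun hf => by
    have h1 := dist0_eq_zero hK hc hf
    have h2 := dist0_pos hK h0 hc hne (hnf x hx)
    have h3 := rho0_nonneg (K := K) (w - x)
    linarith
  have hwΩ : w ∈ Ω := by
    by_contra h
    exact hwf ⟨hwΩ, by rwa [hΩ.interior_eq]⟩
  suffices hwS : w ∈ S by
    refine le_antisymm (maxConv_le_dist0 hK hc hne hS x) ?_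
    have := le_maxConv hK hc hne hS (Or.inl hwS) x
    linarith
  by_contra hwS
  obtain ⟨r, hr, hball⟩ := Metric.nhds_basis_closedBall.mem_iff.1
    ((hΩ.inter hS.isClosed.isOpen_compl).mem_nhds ⟨hwΩ, hwS⟩)
  obtain ⟨w', hw', hdw'⟩ := exists_dist0_eq_add hn hK h0 hc hne hr (z := w) (K := K) (Ω := Ω)
    fun v hv => by
      have hv' := hball (Metric.ball_subset_closedBall hv)
      refine ⟨hnf v hv'.1, ?_⟩
      by_contra hnd
      exact hv'.2 (hsing ⟨hv'.1, hnd⟩)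
  have hpos : 0 < rho0 K (w' - w) := rho0_pos hK h0 (sub_ne_zero.2 fun h => by
    rw [h, Metric.mem_sphere, dist_self] at hw'
    exact hr.ne hw')
  -- Unit-rate growth is transitive: the equalities from `x` to `w` and from `w` to `w'` put `w'` in
  -- `M`.
  have hle : dist0 K Ω w' ≤ dist0 K Ω w := by
    refine hmax ⟨subset_closure (hball (Metric.sphere_subset_closedBall hw')).1, ?_⟩
    have h1 := dist0_sub_le hK hc hne w' x
    have h2 := rho0_sub_le hK w' w x
    linarith
  linarith

end MaxConv

theorem proposition4p4 (n : ℕ) (hn : 1 ≤ n)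
    (K : Set (EuclideanSpace ℝ (Fin n))) (hK : IsC2PlusBody K)
    (Ω : Set (EuclideanSpace ℝ (Fin n)))
    (hΩ_open : IsOpen Ω) (hΩ_bdd : Bornology.IsBounded Ω) (hΩ_conn : IsConnected Ω)
    (S : Set (EuclideanSpace ℝ (Fin n))) (hS_closed : IsClosed S) (hS : S ⊆ closure Ω) :
    -- the minimum defining `d` and the maximum defining `u_S` are attained
    (∀ x ∈ closure Ω,
      IsLeast ((fun y => rho0 K (x - y)) '' frontier Ω) (dist0 K Ω x) ∧
      IsGreatest ((fun z => dist0 K Ω z - rho0 K (z - x)) '' (S ∪ frontier Ω))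
        (maxConv K Ω S x)) ∧
    -- (i)
    MemLip10 K Ω (maxConv K Ω S) ∧
    -- (ii)
    ((∀ x ∈ closure Ω, maxConv K Ω S x ≤ dist0 K Ω x) ∧
      (∀ x ∈ closure (transportSet K Ω S) ∪ S, maxConv K Ω S x = dist0 K Ω x) ∧
      (∀ z ∈ S ∩ Ω, ∀ y ∈ proj K Ω z, ∀ x ∈ openSeg y z,
        DifferentiableAt ℝ (dist0 K Ω) x ∧ DifferentiableAt ℝ (maxConv K Ω S) x ∧
          ∇ (maxConv K Ω S) x = ∇ (dist0 K Ω) x)) ∧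
    -- (iii)
    (∀ u : EuclideanSpace ℝ (Fin n) → ℝ, MemLip10 K Ω u → (∀ x ∈ S, u x = dist0 K Ω x) →
      ∀ x ∈ Ω, maxConv K Ω S x ≤ u x) ∧
    -- (iv)
    (∀ x ∈ Ω \ S, DifferentiableAt ℝ (maxConv K Ω S) x →
      rho K (∇ (maxConv K Ω S) x) = 1) ∧
    -- (v)
    ((∀ x ∈ Ω, maxConv K Ω S x = dist0 K Ω x) ↔ singularSet K Ω ⊆ S) := by
  have hb := hK.isCompact.isBounded
  have h0 := hK.zero_mem_interior
  have : Nonempty (Fin n) := ⟨⟨0, hn⟩⟩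
  have hSc : IsCompact S := hΩ_bdd.isCompact_closure.of_isClosed_subset hS_closed hS
  have hc : IsCompact (frontier Ω) :=
    hΩ_bdd.isCompact_closure.of_isClosed_subset isClosed_frontier frontier_subset_closure
  -- A bounded set is not all of `ℝⁿ` because `n ≥ 1`.
  have hne : (frontier Ω).Nonempty := by
    refine nonempty_frontier_iff.2 ⟨hΩ_conn.nonempty, fun h => ?_⟩
    exact NormedSpace.unbounded_univ ℝ (EuclideanSpace ℝ (Fin n)) (h ▸ hΩ_bdd)
  have hnf : ∀ x ∈ Ω, x ∉ frontier Ω := fun x hx hf => by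
    rw [frontier, hΩ_open.interior_eq] at hf
    exact hf.2 hx
  refine ⟨fun x _ => ⟨isLeast_dist0 hb hc hne x, isGreatest_maxConv hb hc hne hSc x⟩,
    memLip10_maxConv hb hc hne hSc, ⟨fun x _ => maxConv_le_dist0 hb hc hne hSc x, ?_, ?_⟩,
    fun u hu huS x hx => maxConv_le_of_memLip10 hb hΩ_open hc hne hSc hu huS hx, ?_,
    fun h => hK.singularSet_subset hΩ_open hc hne hSc h,
    fun h x hx =>
      maxConv_eq_dist0_of_singularSet_subset hn hb h0 hΩ_open hΩ_bdd hne hSc h hx⟩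
  · rintro x (hx | hx)
    · exact maxConv_eq_dist0_of_mem_closure hb hc hne hSc hx
    · exact maxConv_eq_dist0_of_mem hb hc hne hSc (Or.inl hx)
  · exact fun z hz y hy x hx => hK.differentiableAt_of_mem_openSeg hc hne hSc hz.1 hy hx
  · exact fun x hx hd =>
      hK.rho_gradient_maxConv hc hne hSc (fun h => h.elim hx.2 (hnf x hx.1)) hd
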